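/- Let $T>0$, $\omega=2\pi/T$, and let $J:\mathbb R\to\mathbb C^{n\times n}$ be a $T$-periodic matrix function (real matrices are a special case) which is the pointwise sum of its Fourier series, $J(t)=\sum_{k\in\mathbb Z}J_k e^{ik\omega t}$, with Fourier coefficient matrices $J_k\in\mathbb C^{n\times n}$. Let $\|\cdot\|$ be the matrix norm induced by a vector $p$-norm, $1\le p\le\infty$, and suppose that there are constants $a,b>0$ with $\|J_k\|\le a e^{-b|k|}$ for all $k\in\mathbb Z$, and that $b>\ln 2$. Let $\Phi$ be the fundamental solution matrix, $\dot\Phi(t)=J(t)\Phi(t)$ for $t\in\mathbb R$, $\Phi(0)=I$. For $N\in\mathbb N=\{0,1,2,\dots\}$ let $\tilde J_k=J_{k/2}$ for even $k$ and $\tilde J_k=0$ for odd $k$, and let $\tilde H$ be the subharmonic Hill matrix, with $(4N+1)\times(4N+1)$ blocks of size $n\times n$, whose block in row $k$ and column $l$, $k,l\in\{-2N,\dots,2N\}$, is $\tilde J_{k-l}$, minus $ik\tfrac{\omega}{2}I$ if $k=l$. Let $\tilde D=\operatorname{diag}(-N,-N+\tfrac12,\dots,N-\tfrac12,N)\otimes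 I$, $\tilde W=(I,\dots,I)^{\top}\in\mathbb R^{n(4N+1)\times n}$, $C_{\mathrm{subh}}=(I,-I,I,\dots,-I,I)\in\mathbb R^{n\times n(4N+1)}$, and let $\Phi_{\mathrm{subh}}(t)=C_{\mathrm{subh}}\,e^{i\omega\tilde D t}\,e^{\tilde H t}\,\tilde W$ be the subharmonic Koopman-Hill projection of truncation order $N$. Then: 1. For all $N\in\mathbb N$ and $t\in\mathbb R$, $$\|\Phi(t)-\Phi_{\mathrm{subh}}(t)\|\le(2e^{-b})^{2N}\left(e^{|4at|}-1\right).$$ 2. This bound equals $e^{-2(b-\ln 2)N}(e^{|4at|}-1)$ with $b-\ln2>0$, so it decays exponentially in $N$, at twice the rate $b-\ln 2$ of the direct bound $(2e^{-b})^{N}(e^{|4at|}-1)=e^{-(b-\ln2)N}(e^{|4at|}-1)$. In particular $\Phi_{\mathrm{subh}}(t)\to\Phi(t)$ as $N\to\infty$ for every $t\in\mathbb R$. 3. For every $E_{\mathrm{des}}>0$, the accuracy $\|\Phi(t)-\Phi_{\mathrm{subh}}(t)\|\le E_{\mathrm{des}}$ is guaranteed if $$N\ge\tilde N^*=\frac{|4at|+\ln\left(1-e^{-|4at|}\right)-\ln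 E_{\mathrm{des}}}{2(b-\ln 2)}$$ (for $t=0$ every $N$ suffices). This is half of the order $N^*=\frac{|4at|+\ln(1-e^{-|4at|})-\ln E_{\mathrm{des}}}{b-\ln 2}$ of the direct formulation. -/

import Mathlib

open Filter Topology
open scoped ENNReal

noncomputable section

namespace KoopmanHill

/-- The induced matrix `p`-norm: the operator norm of `A` on `ℂⁿ` with the `ℓᵖ` norm. -/
def matPNorm (p : ℝ≥0∞) [Fact (1 ≤ p)] {n : ℕ} (A : Matrix (Fin n) (Fin n) ℂ) : ℝ :=
  ‖LinearMap.toContinuousLinearMap (Matrix.toLpLin p p A)‖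

/-- The `k`-th Fourier coefficient matrix `J_k = (1/T) ∫₀ᵀ J(t) e^{-ikωt} dt`, with `ω = 2π/T`,
of a matrix function (entry by entry). -/
def fourierCoeffMatrix {n : ℕ} {T : ℝ} (hT : 0 < T) (J : ℝ → Matrix (Fin n) (Fin n) ℂ) (k : ℤ) :
    Matrix (Fin n) (Fin n) ℂ :=
  Matrix.of fun i j => fourierCoeffOn hT (fun t => J t i j) k

/-- `J(t) = ∑_{k ∈ ℤ} c_k e^{ikωt}` for all real `t`, as limit of the symmetric partial sums. -/
def IsFourierSum {n : ℕ} (ω : ℝ) (c : ℤ → Matrix (Fin n) (Fin n) ℂ)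
    (J : ℝ → Matrix (Fin n) (Fin n) ℂ) : Prop :=
  ∀ t : ℝ, Tendsto
    (fun K : ℕ => ∑ k ∈ Finset.Icc (-(K : ℤ)) (K : ℤ),
      Complex.exp (Complex.I * (k : ℂ) * (ω : ℂ) * (t : ℂ)) • c k)
    atTop (𝓝 (J t))

/-- Exponential decay `‖c_k‖_p ≤ a e^{-b|k|}` with constants `a, b > 0`. -/
def ExpDecay {n : ℕ} (p : ℝ≥0∞) [Fact (1 ≤ p)] (a b : ℝ)
    (c : ℤ → Matrix (Fin n) (Fin n) ℂ) : Prop :=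
  0 < a ∧ 0 < b ∧ ∀ k : ℤ, matPNorm p (c k) ≤ a * Real.exp (-b * |(k : ℝ)|)

/-- `Φ` is the (principal) fundamental solution matrix of `y' = J(t) y`:
`Φ' = J Φ` on the real line and `Φ(0) = I`. -/
def IsFundamentalSolution {n : ℕ} (J Φ : ℝ → Matrix (Fin n) (Fin n) ℂ) : Prop :=
  Φ 0 = 1 ∧ ∀ t : ℝ, HasDerivAt Φ (J t * Φ t) t

/-- The integer index in `{-M, …, M}` of the `r`-th of `2M + 1` blocks. -/
def blockIndex (M : ℕ) (r : Fin (2 * M + 1)) : ℤ := ((r : ℕ) : ℤ) - (M : ℤ)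

/-- The truncated Hill matrix of order `M` for base frequency `ω` and coefficients `c`: the block
in row `k` and column `l` (`k, l ∈ {-M, …, M}`) is `c_{k-l}`, minus `i k ω I` if `k = l`. -/
def hillMatrix {n : ℕ} (ω : ℝ) (c : ℤ → Matrix (Fin n) (Fin n) ℂ) (M : ℕ) :
    Matrix (Fin (2 * M + 1) × Fin n) (Fin (2 * M + 1) × Fin n) ℂ :=
  Matrix.of fun x y =>
    c (blockIndex M x.1 - blockIndex M y.1) x.2 y.2
      - (if x = y then Complex.I * (blockIndex M x.1 : ℂ) * (ω : ℂ) else 0)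

/-- The coefficients of the same Fourier series read with the halved base frequency: `c_{k/2}` for
even `k` and `0` for odd `k`. -/
def subhCoeff {n : ℕ} (c : ℤ → Matrix (Fin n) (Fin n) ℂ) (k : ℤ) : Matrix (Fin n) (Fin n) ℂ :=
  if Even k then c (k / 2) else 0

/-- The subharmonic Hill matrix `H̃`: the Hill matrix of order `2N` with base frequency `ω/2` and
the coefficients `subhCoeff c`. It has `(4N+1) × (4N+1)` blocks of size `n × n`. -/
def subhHill {n : ℕ} (ω : ℝ) (c : ℤ → Matrix (Fin n) (Fin n) ℂ) (N : ℕ) :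
    Matrix (Fin (2 * (2 * N) + 1) × Fin n) (Fin (2 * (2 * N) + 1) × Fin n) ℂ :=
  hillMatrix (ω / 2) (subhCoeff c) (2 * N)

/-- `D̃ = diag(-N, -N + 1/2, …, N - 1/2, N) ⊗ I`. -/
def subhD (n N : ℕ) :
    Matrix (Fin (2 * (2 * N) + 1) × Fin n) (Fin (2 * (2 * N) + 1) × Fin n) ℂ :=
  Matrix.diagonal fun x => (blockIndex (2 * N) x.1 : ℂ) / 2

/-- `W̃ = (I, …, I)ᵀ`, a vertical stack of `4N+1` identity matrices. -/
def subhW (n N : ℕ) : Matrix (Fin (2 * (2 * N) + 1) × Fin n) (Fin n) ℂ :=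
  Matrix.of fun x j => if x.2 = j then 1 else 0

/-- `C_subh = (I, -I, I, …, -I, I)`, a row of `4N+1` blocks with alternating signs. -/
def subhC (n N : ℕ) : Matrix (Fin n) (Fin (2 * (2 * N) + 1) × Fin n) ℂ :=
  Matrix.of fun i x => if i = x.2 then (-1) ^ (x.1 : ℕ) else 0

/-- The subharmonic Koopman-Hill projection `Φ_subh(t) = C_subh e^{iωD̃t} e^{H̃t} W̃`. -/
def subhProjection {n : ℕ} (ω : ℝ) (c : ℤ → Matrix (Fin n) (Fin n) ℂ) (N : ℕ) (t : ℝ) :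
    Matrix (Fin n) (Fin n) ℂ :=
  subhC n N
    * NormedSpace.exp ((Complex.I * (ω : ℂ) * (t : ℂ)) • subhD n N)
    * NormedSpace.exp ((t : ℂ) • subhHill ω c N)
    * subhW n N

/-- The error bound `(2e^{-b})^N (e^{|4at|} - 1)` of the direct formulation. -/
def directBound (a b t : ℝ) (N : ℕ) : ℝ :=
  (2 * Real.exp (-b)) ^ N * (Real.exp |4 * a * t| - 1)

/-- The error bound `(2e^{-b})^{2N} (e^{|4at|} - 1)` of the subharmonic formulation. -/
def subhBound (a b t : ℝ) (N : ℕ) : ℝ :=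
  (2 * Real.exp (-b)) ^ (2 * N) * (Real.exp |4 * a * t| - 1)

/-- The truncation order `N*` of the direct formulation (for `t ≠ 0` and `E > 0`). -/
def directOrder (a b t E : ℝ) : ℝ :=
  (|4 * a * t| + Real.log (1 - Real.exp (-|4 * a * t|)) - Real.log E) / (b - Real.log 2)

/-- The truncation order `Ñ*` of the subharmonic formulation (for `t ≠ 0` and `E > 0`). -/
def subhOrder (a b t E : ℝ) : ℝ :=
  (|4 * a * t| + Real.log (1 - Real.exp (-|4 * a * t|)) - Real.log E) / (2 * (b - Real.log 2))

end KoopmanHill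

end

/-! Put `g k t = e^{ikωt} J_k`. Multiplying each block row of `e^{H̃t} W̃` by its phase removes the
diagonal of `H̃`. Since `J̃_k = 0` for odd `k`, even and odd rows then decouple into two copies of
`y_j' = ∑_k g_k y_{j-k}`, `y_j(0) = I`, truncated to the windows `[0, L]` and `[1, L]` with `L =
2N`. As `J = ∑_k g_k`, the constant family `y_j = Φ` solves the untruncated system.

Each solution is the sum of its Dyson series over words `w`: the iterated integral does not depend
on the starting site `j`, and truncation keeps exactly the words whose path from `j` stays in the
window (`hasSum_windowTerm`). The alternating signs of `C_subh` subtract the odd window from the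
even one. A word whose path has range `ρ` fits `(L + 1 - ρ)⁺` times in the first and `(L - ρ)⁺`
times in the second, so it survives with coefficient 1 if `ρ ≤ L` and 0 otherwise
(`sum_staysIn_Icc_sub`). The projection is thus the Dyson series of `Φ` without the words of range
above `L`.

Such words have `∑ |w_i| ≥ L`. With `q = e^{-b} < 1/2`, writing `q = (2q)(1/2)` extracts the factor
`(2q)^L`, and `∑_k (1/2)^{|k|} = 3` leaves `e^{3a|t|} - 1`, the empty word being always kept
(`norm_windowTerm_sub_le`, `norm_sub_window_le`). -/

namespace KoopmanHill

open scoped Nat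

/-! ### Dyson series of convolution systems restricted to a set of sites -/

section WordSeries

variable {B : Type*} [NormedRing B] [NormedAlgebra ℝ B]

/-- A function vanishing at `0` whose derivative is at most `C |s|^m / m!` is at most
`C |t|^(m+1) / (m+1)!`. -/
lemma norm_le_of_norm_deriv_le_pow {F F' : ℝ → B} (hF : ∀ s, HasDerivAt F (F' s) s)
    (h0 : F 0 = 0) {C R : ℝ} {m : ℕ} (hb : ∀ s, |s| ≤ R → ‖F' s‖ ≤ C * |s| ^ m / m !)
    (t : ℝ) (ht : |t| ≤ R) : ‖F t‖ ≤ C * |t| ^ (m + 1) / (m + 1)! := by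
  have key : ∀ {G G' : ℝ → B}, (∀ s, HasDerivAt G (G' s) s) → G 0 = 0 →
      (∀ s, |s| ≤ R → ‖G' s‖ ≤ C * |s| ^ m / m !) → ∀ r, 0 ≤ r → r ≤ R →
      ‖G r‖ ≤ C * r ^ (m + 1) / (m + 1)! := by
    intro G G' hG hG0 hGb r hr hrR
    refine image_norm_le_of_norm_deriv_right_le_deriv_boundary (a := 0) (b := r)
      (B := fun x => C * x ^ (m + 1) / (m + 1)!) (B' := fun x => C * x ^ m / m !)
      (fun x _ => (hG x).continuousAt.continuousWithinAt)
      (fun x _ => (hG x).hasDerivWithinAt) (by simp [hG0]) ?_ ?_ ⟨hr, le_rfl⟩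
    · intro x
      have h := ((hasDerivAt_pow (m + 1) x).const_mul C).div_const ((m + 1)! : ℝ)
      refine h.congr_deriv ?_
      rw [Nat.factorial_succ]
      push_cast
      have : (m ! : ℝ) ≠ 0 := by positivity
      have : (m : ℝ) + 1 ≠ 0 := by positivity
      field_simp
    · intro x hx
      have := hGb x (by rw [abs_of_nonneg hx.1]; exact hx.2.le.trans hrR)
      rwa [abs_of_nonneg hx.1] at this
  rcases le_total 0 t with h | h
  · rw [abs_of_nonneg h] at ht ⊢
    exact key hF h0 hb t h ht
  · rw [abs_of_nonpos h] at ht ⊢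
    -- Negative times reduce to positive ones by the reflection `s ↦ -s`.
    have := key (G := fun s => F (-s)) (G' := fun s => -F' (-s))
      (fun s => by
        have := (hF (-s)).scomp s (hasDerivAt_neg s)
        simpa [Function.comp_def] using this)
      (by simpa using h0) (fun s hs => by simpa using hb (-s) (by simpa using hs)) (-t)
      (by linarith) ht
    simpa using this

lemma hasSum_prod_fin {f : ℤ → ℝ} {S : ℝ} (hf : HasSum f S) (hf0 : ∀ k, 0 ≤ f k) (m : ℕ) :
    HasSum (fun w : Fin m → ℤ => ∏ i, f (w i)) (S ^ m) := by
  induction m with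
  | zero => simp
  | succ m ih =>
    rw [← (Fin.consEquiv fun _ : Fin (m + 1) => ℤ).hasSum_iff, pow_succ']
    have hs := hf.summable.mul_of_nonneg ih.summable hf0
      (fun w => Finset.prod_nonneg fun i _ => hf0 _)
    refine (hf.mul ih hs).congr_fun fun ⟨k, w⟩ => ?_
    simp [Fin.consEquiv, Fin.prod_univ_succ]

/-- The iterated (Dyson) integral of `g (w 0)`, …, `g (w (m-1))`, with `w 0` outermost. -/
noncomputable def wordIntegral (g : ℤ → ℝ → B) : (m : ℕ) → (Fin m → ℤ) → ℝ → B
  | 0, _, _ => 1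
  | m + 1, w, t => ∫ s in (0 : ℝ)..t, g (w 0) s * wordIntegral g m (Fin.tail w) s

/-- All positions of the path `j`, `j - w 0`, `j - w 0 - w 1`, … lie in `A`. -/
def StaysIn (A : Set ℤ) : (m : ℕ) → (Fin m → ℤ) → ℤ → Prop
  | 0, _, j => j ∈ A
  | m + 1, w, j => j ∈ A ∧ StaysIn A m (Fin.tail w) (j - w 0)

lemma StaysIn.mem {A : Set ℤ} {m : ℕ} {w : Fin m → ℤ} {j : ℤ} (h : StaysIn A m w j) : j ∈ A := by
  cases m with
  | zero => exact h
  | succ m => exact h.1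

lemma staysIn_univ {m : ℕ} (w : Fin m → ℤ) (j : ℤ) : StaysIn Set.univ m w j := by
  induction m generalizing j with
  | zero => trivial
  | succ m ih => exact ⟨trivial, ih _ _⟩

open Classical in
/-- The order-`m` part of the solution component `j` of the system restricted to `A`. -/
noncomputable def windowTerm (g : ℤ → ℝ → B) (A : Set ℤ) (m : ℕ) (j : ℤ) (t : ℝ) : B :=
  ∑' w : Fin m → ℤ, if StaysIn A m w j then wordIntegral g m w t else 0

variable {g : ℤ → ℝ → B}

lemma continuous_wordIntegral (hg : ∀ k, Continuous (g k)) (m : ℕ) (w : Fin m → ℤ) : Continuous (wordIntegral g m w) := by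
  induction m with
  | zero => exact continuous_const
  | succ m ih =>
    refine intervalIntegral.continuous_primitive (fun a b => ?_) 0
    exact ((hg _).mul (ih _)).intervalIntegrable a b

lemma wordIntegral_zero (m : ℕ) (w : Fin (m + 1) → ℤ) : wordIntegral g (m + 1) w 0 = 0 := by
  simp [wordIntegral]

lemma windowTerm_zero_of_mem (g : ℤ → ℝ → B) {A : Set ℤ} {j : ℤ} (hj : j ∈ A) (t : ℝ) :
    windowTerm g A 0 j t = 1 := by
  rw [windowTerm, tsum_fintype]
  simp [StaysIn, wordIntegral, hj]

lemma windowTerm_eq_zero_of_notMem (g : ℤ → ℝ → B) {A : Set ℤ} {j : ℤ} (hj : j ∉ A) (m : ℕ)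
    (t : ℝ) : windowTerm g A m j t = 0 := by
  rw [windowTerm]
  convert tsum_zero with w
  exact if_neg fun h => hj h.mem

lemma windowTerm_succ_zero (g : ℤ → ℝ → B) (A : Set ℤ) (m : ℕ) (j : ℤ) :
    windowTerm g A (m + 1) j 0 = 0 := by
  simp [windowTerm, wordIntegral_zero]

variable [CompleteSpace B]

lemma hasDerivAt_wordIntegral (hg : ∀ k, Continuous (g k)) (m : ℕ) (w : Fin (m + 1) → ℤ) (t : ℝ) :
    HasDerivAt (wordIntegral g (m + 1) w) (g (w 0) t * wordIntegral g m (Fin.tail w) t) t := by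
  have hc := (hg (w 0)).mul (continuous_wordIntegral hg m (Fin.tail w))
  exact intervalIntegral.integral_hasDerivAt_right (hc.intervalIntegrable _ _)
    hc.stronglyMeasurable.stronglyMeasurableAtFilter hc.continuousAt

/-- The factor `|t|^m / m!` is the volume of the simplex of ordered times. -/
lemma norm_wordIntegral_le (hg : ∀ k, Continuous (g k)) {f : ℤ → ℝ} (hgf : ∀ k t, ‖g k t‖ ≤ f k)
    (h1 : ‖(1 : B)‖ ≤ 1) (m : ℕ) (w : Fin m → ℤ) (t : ℝ) :
    ‖wordIntegral g m w t‖ ≤ (∏ i, f (w i)) * |t| ^ m / m ! := by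
  induction m generalizing t with
  | zero => simpa [wordIntegral] using h1
  | succ m ih =>
    refine norm_le_of_norm_deriv_le_pow (hasDerivAt_wordIntegral hg m w) (wordIntegral_zero m w)
      (fun s _ => ?_) t le_rfl
    calc _ ≤ ‖g (w 0) s‖ * ‖wordIntegral g m (Fin.tail w) s‖ := norm_mul_le _ _
      _ ≤ f (w 0) * ((∏ i, f (Fin.tail w i)) * |s| ^ m / m !) :=
        mul_le_mul (hgf _ _) (ih _ _) (norm_nonneg _) ((norm_nonneg _).trans (hgf (w 0) s))
      _ = _ := by rw [Fin.prod_univ_succ]; simp only [Fin.tail]; ring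

variable {f : ℤ → ℝ} {S : ℝ}

lemma summable_wordBound (hf : HasSum f S) (hf0 : ∀ k, 0 ≤ f k) (m : ℕ) (t : ℝ) :
    Summable fun w : Fin m → ℤ => (∏ i, f (w i)) * |t| ^ m / m ! := by
  simp only [mul_div_assoc]
  exact (hasSum_prod_fin hf hf0 m).summable.mul_right _

open Classical in
lemma summable_windowTerm (hg : ∀ k, Continuous (g k)) (hgf : ∀ k t, ‖g k t‖ ≤ f k)
    (hf : HasSum f S) (h1 : ‖(1 : B)‖ ≤ 1) (A : Set ℤ) (m : ℕ) (j : ℤ) (t : ℝ) :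
    Summable fun w : Fin m → ℤ => if StaysIn A m w j then wordIntegral g m w t else 0 := by
  have hf0 : ∀ k, 0 ≤ f k := fun k => (norm_nonneg _).trans (hgf k 0)
  refine Summable.of_norm_bounded (summable_wordBound hf hf0 m t) fun w => ?_
  have h := norm_wordIntegral_le hg hgf h1 m w t
  split_ifs
  · exact h
  · rw [norm_zero]; exact (norm_nonneg _).trans h

-- Differentiating an iterated integral strips the outermost letter `k = w 0`, and the remaining
-- path starts at `j - k`. No window condition is needed on the right, because terms with `j - k ∉
-- A` vanish.
open Classical in
lemma hasDerivAt_windowTerm (hg : ∀ k, Continuous (g k)) (hgf : ∀ k t, ‖g k t‖ ≤ f k)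
    (hf : HasSum f S) (h1 : ‖(1 : B)‖ ≤ 1) {A : Set ℤ} {j : ℤ} (hj : j ∈ A) (m : ℕ) (t : ℝ) :
    HasDerivAt (windowTerm g A (m + 1) j) (∑' k, g k t * windowTerm g A m (j - k) t) t := by
  have hf0 : ∀ k, 0 ≤ f k := fun k => (norm_nonneg _).trans (hgf k 0)
  -- The extra 1 makes the open ball contain `t` as well as `0`, where the series is known to
  -- converge.
  set R : ℝ := |t| + 1
  set G' : (Fin (m + 1) → ℤ) → ℝ → B := fun w s =>
    if StaysIn A (m + 1) w j then g (w 0) s * wordIntegral g m (Fin.tail w) s else 0 with hG'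
  have hR : 0 ≤ R := by positivity
  have hbd : ∀ w s, |s| ≤ R → ‖G' w s‖ ≤ (∏ i, f (w i)) * (R ^ m / m !) := by
    intro w s hs
    have h0 : 0 ≤ (∏ i, f (w i)) * (R ^ m / m !) :=
      mul_nonneg (Finset.prod_nonneg fun i _ => hf0 _) (by positivity)
    simp only [hG']
    split_ifs
    · calc _ ≤ ‖g (w 0) s‖ * ‖wordIntegral g m (Fin.tail w) s‖ := norm_mul_le _ _
        _ ≤ f (w 0) * ((∏ i, f (Fin.tail w i)) * |s| ^ m / m !) :=
          mul_le_mul (hgf _ _) (norm_wordIntegral_le hg hgf h1 _ _ _) (norm_nonneg _) (hf0 _)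
        _ = (∏ i, f (w i)) * (|s| ^ m / m !) := by
          rw [Fin.prod_univ_succ]; simp only [Fin.tail]; ring
        _ ≤ _ := by
          gcongr
          exact Finset.prod_nonneg fun i _ => hf0 _
    · simpa using h0
  have hsum : Summable fun w : Fin (m + 1) → ℤ => (∏ i, f (w i)) * (R ^ m / m !) :=
    (hasSum_prod_fin hf hf0 (m + 1)).summable.mul_right _
  have hmem : ∀ s, s ∈ Metric.ball (0 : ℝ) R → |s| ≤ R := fun s hs => by
    simpa using (mem_ball_zero_iff.1 hs).le
  have htR : |t| ≤ R := by simp [R]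
  have hd := hasDerivAt_tsum_of_isPreconnected (t := Metric.ball (0 : ℝ) R) (y₀ := 0) (y := t)
    (g := fun (w : Fin (m + 1) → ℤ) s =>
      if StaysIn A (m + 1) w j then wordIntegral g (m + 1) w s else 0) (g' := G')
    hsum Metric.isOpen_ball (convex_ball _ _).isPreconnected
    (fun w s _ => by
      simp only [hG']
      split_ifs
      · exact hasDerivAt_wordIntegral hg m w s
      · exact hasDerivAt_const _ _)
    (fun w s hs => hbd w s (hmem s hs)) (Metric.mem_ball_self (by positivity))
    (summable_windowTerm hg hgf hf h1 A (m + 1) j 0) (by simp [R])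
  have hs' : Summable fun w => G' w t := Summable.of_norm_bounded hsum fun w => hbd w t htR
  refine hd.congr_deriv ?_
  rw [← (Fin.consEquiv fun _ : Fin (m + 1) => ℤ).tsum_eq,
    Summable.tsum_prod (f := fun c => G' (Fin.consEquiv (fun _ : Fin (m + 1) => ℤ) c) t)
      ((Fin.consEquiv fun _ : Fin (m + 1) => ℤ).summable_iff.2 hs')]
  refine tsum_congr fun k => ?_
  rw [windowTerm, ← (summable_windowTerm hg hgf hf h1 A m (j - k) t).tsum_mul_left]
  refine tsum_congr fun w => ?_
  simp [hG', Fin.consEquiv, StaysIn, hj, Fin.tail_cons]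

lemma norm_windowTerm_le (hg : ∀ k, Continuous (g k)) (hgf : ∀ k t, ‖g k t‖ ≤ f k)
    (hf : HasSum f S) (h1 : ‖(1 : B)‖ ≤ 1) (A : Set ℤ) (m : ℕ) (j : ℤ) (t : ℝ) :
    ‖windowTerm g A m j t‖ ≤ S ^ m * |t| ^ m / m ! := by
  classical
  have hf0 : ∀ k, 0 ≤ f k := fun k => (norm_nonneg _).trans (hgf k 0)
  have hs : HasSum (fun w : Fin m → ℤ => (∏ i, f (w i)) * |t| ^ m / m !) (S ^ m * |t| ^ m / m !) :=
    by simpa only [mul_div_assoc] using (hasSum_prod_fin hf hf0 m).mul_right (|t| ^ m / m !)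
  refine tsum_of_norm_bounded hs fun w => ?_
  have h := norm_wordIntegral_le hg hgf h1 m w t
  split_ifs
  · exact h
  · rw [norm_zero]; exact (norm_nonneg _).trans h

/-- A locally uniformly bounded solution of the system restricted to `A`, started at `1`, is the sum
of its Dyson series. -/
theorem hasSum_windowTerm (hg : ∀ k, Continuous (g k)) (hgf : ∀ k t, ‖g k t‖ ≤ f k)
    (hf : HasSum f S) (h1 : ‖(1 : B)‖ ≤ 1) {A : Set ℤ} [DecidablePred (· ∈ A)] {y : ℤ → ℝ → B}
    (hy0 : ∀ j ∈ A, y j 0 = 1)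
    (hy : ∀ j ∈ A, ∀ t,
      HasDerivAt (y j) (∑' k, if j - k ∈ A then g k t * y (j - k) t else 0) t)
    (hbd : ∀ R, ∃ C, ∀ j ∈ A, ∀ t, |t| ≤ R → ‖y j t‖ ≤ C) {j : ℤ} (hj : j ∈ A) (t : ℝ) :
    HasSum (fun m => windowTerm g A m j t) (y j t) := by
  have hf0 : ∀ k, 0 ≤ f k := fun k => (norm_nonneg _).trans (hgf k 0)
  have hS : 0 ≤ S := hf.nonneg hf0
  obtain ⟨C, hC⟩ := hbd |t|
  have hC0 : 0 ≤ C := (norm_nonneg _).trans (hC j hj t le_rfl)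
  -- Picard iteration: the derivative of the next remainder is `∑_k g_k` times the current
  -- remainders at the sites `j - k`, so each integration gains a factor `S|s|/(m+1)`.
  have hrem : ∀ m : ℕ, ∀ j ∈ A, ∀ s, |s| ≤ |t| →
      ‖y j s - ∑ i ∈ Finset.range m, windowTerm g A i j s‖ ≤ C * S ^ m * |s| ^ m / m ! := by
    intro m
    induction m with
    | zero => intro j hj s hs; simpa using hC j hj s hs
    | succ m ih =>
      intro j hj
      have hsy : ∀ s, |s| ≤ |t| →
          Summable fun k => if j - k ∈ A then g k s * y (j - k) s else 0 := by
        intro s hs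
        refine Summable.of_norm_bounded (hf.summable.mul_right C) fun k => ?_
        split_ifs with h
        · exact (norm_mul_le _ _).trans
            (mul_le_mul (hgf _ _) (hC _ h s hs) (norm_nonneg _) (hf0 _))
        · rw [norm_zero]; exact mul_nonneg (hf0 _) hC0
      have hsw : ∀ i s, Summable fun k => g k s * windowTerm g A i (j - k) s := by
        intro i s
        refine Summable.of_norm_bounded (hf.summable.mul_right (S ^ i * |s| ^ i / i !))
          fun k => (norm_mul_le _ _).trans ?_
        exact mul_le_mul (hgf _ _) (norm_windowTerm_le hg hgf hf h1 A i _ s) (norm_nonneg _)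
          (hf0 _)
      refine norm_le_of_norm_deriv_le_pow
        (F' := fun s => (∑' k, if j - k ∈ A then g k s * y (j - k) s else 0)
          - ∑ i ∈ Finset.range m, ∑' k, g k s * windowTerm g A i (j - k) s)
        (fun s => ?_) ?_ (fun s hs => ?_)
      · refine (hy j hj s).sub ?_
        -- The order-zero term is constant, so the derivative shifts all orders down by one.
        simp only [Finset.sum_range_succ', windowTerm_zero_of_mem g hj]
        refine HasDerivAt.add_const _ ?_
        exact HasDerivAt.fun_sum fun i _ => hasDerivAt_windowTerm hg hgf hf h1 hj i s
      · simp [Finset.sum_range_succ', windowTerm_zero_of_mem g hj, windowTerm_succ_zero, hy0 j hj]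
      · rw [← Summable.tsum_finsetSum fun i _ => hsw i s,
          ← (hsy s hs).tsum_sub (summable_sum fun i _ => hsw i s)]
        have hh : HasSum (fun k => f k * (C * S ^ m * |s| ^ m / m !))
            (C * S ^ (m + 1) * |s| ^ m / m !) := by
          have h : S * (C * S ^ m * |s| ^ m / m !) = C * S ^ (m + 1) * |s| ^ m / m ! := by ring
          exact h ▸ hf.mul_right (C * S ^ m * |s| ^ m / m !)
        refine tsum_of_norm_bounded hh fun k => ?_
        by_cases h : j - k ∈ A
        · rw [if_pos h, ← Finset.mul_sum, ← mul_sub]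
          exact (norm_mul_le _ _).trans
            (mul_le_mul (hgf _ _) (ih _ h s hs) (norm_nonneg _) (hf0 _))
        · simp only [if_neg h, windowTerm_eq_zero_of_notMem g h]
          simp only [mul_zero, Finset.sum_const_zero, sub_zero, norm_zero]
          exact mul_nonneg (hf0 _) (by positivity)
  have hsum : Summable fun m => windowTerm g A m j t := by
    refine Summable.of_norm_bounded (Real.summable_pow_div_factorial (S * |t|)) fun m => ?_
    rw [mul_pow]
    exact norm_windowTerm_le hg hgf hf h1 A m j t
  refine (hsum.hasSum_iff_tendsto_nat).2 ?_
  rw [← tendsto_sub_nhds_zero_iff]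
  refine squeeze_zero_norm (fun m => ?_)
    (by simpa using (FloorSemiring.tendsto_pow_div_factorial_atTop (S * |t|)).const_mul C)
  rw [norm_sub_rev]
  refine (hrem m j hj t le_rfl).trans_eq ?_
  rw [mul_pow]; ring

end WordSeries

/-! ### Ranges of paths and the counting of starting points -/

section PathRange

/-- The least displacement along the path `0`, `-w 0`, `-w 0 - w 1`, …. -/
def pathMin : (m : ℕ) → (Fin m → ℤ) → ℤ
  | 0, _ => 0
  | m + 1, w => min 0 (pathMin m (Fin.tail w) - w 0)

/-- The largest displacement along the path `0`, `-w 0`, `-w 0 - w 1`, …. -/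
def pathMax : (m : ℕ) → (Fin m → ℤ) → ℤ
  | 0, _ => 0
  | m + 1, w => max 0 (pathMax m (Fin.tail w) - w 0)

lemma pathMin_nonpos (m : ℕ) (w : Fin m → ℤ) : pathMin m w ≤ 0 := by
  cases m with
  | zero => exact le_rfl
  | succ m => exact min_le_left _ _

lemma pathMax_nonneg (m : ℕ) (w : Fin m → ℤ) : 0 ≤ pathMax m w := by
  cases m with
  | zero => exact le_rfl
  | succ m => exact le_max_left _ _

lemma staysIn_Icc_iff (u v : ℤ) (m : ℕ) (w : Fin m → ℤ) (j : ℤ) :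
    StaysIn (Set.Icc u v) m w j ↔ u ≤ j + pathMin m w ∧ j + pathMax m w ≤ v := by
  induction m generalizing j with
  | zero => simp [StaysIn, pathMin, pathMax]
  | succ m ih =>
    simp only [StaysIn, pathMin, pathMax, ih, Set.mem_Icc]
    omega

/-- The tail's range already contains its own starting point, so prepending a step enlarges the
range by at most the length of that step. -/
lemma pathMax_sub_pathMin_le (m : ℕ) (w : Fin m → ℤ) :
    pathMax m w - pathMin m w ≤ ∑ i, ((w i).natAbs : ℤ) := by
  induction m with
  | zero => simp [pathMin, pathMax]
  | succ m ih =>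
    have h := ih (Fin.tail w)
    have h1 := pathMin_nonpos m (Fin.tail w)
    have h2 := pathMax_nonneg m (Fin.tail w)
    rw [Fin.sum_univ_succ]
    simp only [pathMin, pathMax]
    simp only [Fin.tail] at h
    change _ ≤ ((w 0).natAbs : ℤ) + ∑ i : Fin m, ((w i.succ).natAbs : ℤ)
    omega

-- The admissible starting points form the interval `[u - pathMin, v - pathMax]`; `toNat` covers the
-- case where it is empty.
open Classical in
lemma sum_staysIn_Icc {B : Type*} [AddCommGroup B] (u v : ℤ) (m : ℕ) (w : Fin m → ℤ) (x : B) :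
    (∑ j ∈ Finset.Icc u v, if StaysIn (Set.Icc u v) m w j then x else 0)
      = (v + 1 - u - (pathMax m w - pathMin m w)).toNat • x := by
  have h1 := pathMin_nonpos m w
  have h2 := pathMax_nonneg m w
  have hf : (Finset.Icc u v).filter (fun j => StaysIn (Set.Icc u v) m w j)
      = Finset.Icc (u - pathMin m w) (v - pathMax m w) := by
    ext j
    simp only [Finset.mem_filter, Finset.mem_Icc, staysIn_Icc_iff]
    omega
  rw [← Finset.sum_filter, hf, Finset.sum_const, Int.card_Icc]
  congr 2
  omega

open Classical in
/-- The number of starting points in `[0, L]` minus that in `[1, L]` is one or zero, according to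
whether the range of the path is at most `L`. -/
lemma sum_staysIn_Icc_sub {B : Type*} [AddCommGroup B] (L m : ℕ) (w : Fin m → ℤ) (x : B) :
    (∑ j ∈ Finset.Icc (0 : ℤ) L, if StaysIn (Set.Icc (0 : ℤ) L) m w j then x else 0)
      - (∑ j ∈ Finset.Icc (1 : ℤ) L, if StaysIn (Set.Icc (1 : ℤ) L) m w j then x else 0)
      = if pathMax m w - pathMin m w ≤ L then x else 0 := by
  rw [sum_staysIn_Icc, sum_staysIn_Icc]
  split_ifs with h
  · rw [show ((L : ℤ) + 1 - 0 - (pathMax m w - pathMin m w)).toNat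
      = ((L : ℤ) + 1 - 1 - (pathMax m w - pathMin m w)).toNat + 1 by omega, add_smul]
    simp
  · rw [show ((L : ℤ) + 1 - 0 - (pathMax m w - pathMin m w)).toNat = 0 by omega,
      show ((L : ℤ) + 1 - 1 - (pathMax m w - pathMin m w)).toNat = 0 by omega]
    simp

end PathRange

/-! ### Geometric weights and the error of the window difference -/

lemma hasSum_pow_natAbs {r : ℝ} (h0 : 0 ≤ r) (h1 : r < 1) :
    HasSum (fun k : ℤ => r ^ k.natAbs) ((1 + r) / (1 - r)) := by
  have hg := hasSum_geometric_of_lt_one h0 h1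
  have h := HasSum.of_nat_of_neg_add_one (f := fun k : ℤ => r ^ k.natAbs) (m := (1 - r)⁻¹)
    (m' := (1 - r)⁻¹ * r) (by simpa using hg) ?_
  · rwa [show (1 - r)⁻¹ + (1 - r)⁻¹ * r = (1 + r) / (1 - r) by ring] at h
  · refine (hg.mul_right r).congr_fun fun n => ?_
    rw [Int.natAbs_neg, ← pow_succ]
    congr 1

section ErrorBound

variable {B : Type*} [NormedRing B] [NormedAlgebra ℝ B] [CompleteSpace B] {g : ℤ → ℝ → B}
  {a q : ℝ}

lemma hasSum_geometric_coeff (hq0 : 0 ≤ q) (hq : q < 1) :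
    HasSum (fun k : ℤ => a * q ^ k.natAbs) (a * ((1 + q) / (1 - q))) :=
  (hasSum_pow_natAbs hq0 hq).mul_left a

/-- The order-`m` part of the projection error consists of the words of range larger than `L`. -/
lemma norm_windowTerm_sub_le (hg : ∀ k, Continuous (g k))
    (hgf : ∀ k t, ‖g k t‖ ≤ a * q ^ k.natAbs) (ha : 0 ≤ a) (hq0 : 0 ≤ q) (hq : q < 1 / 2)
    (h1 : ‖(1 : B)‖ ≤ 1) (L m : ℕ) (t : ℝ) :
    ‖windowTerm g Set.univ m 0 t - (∑ j ∈ Finset.Icc (0 : ℤ) L, windowTerm g (Set.Icc 0 (L : ℤ)) m j t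
      - ∑ j ∈ Finset.Icc (1 : ℤ) L, windowTerm g (Set.Icc 1 (L : ℤ)) m j t)‖
      ≤ (2 * q) ^ L * ((3 * a * |t|) ^ m / m !) := by
  classical
  have hf := hasSum_geometric_coeff (a := a) hq0 (by linarith)
  have hs := fun A j => summable_windowTerm hg hgf hf h1 A m j t
  have hsum : HasSum (fun w : Fin m → ℤ => if pathMax m w - pathMin m w ≤ L then 0
      else wordIntegral g m w t)
      (windowTerm g Set.univ m 0 t -
        (∑ j ∈ Finset.Icc (0 : ℤ) L, windowTerm g (Set.Icc 0 (L : ℤ)) m j t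
        - ∑ j ∈ Finset.Icc (1 : ℤ) L, windowTerm g (Set.Icc 1 (L : ℤ)) m j t)) := by
    refine ((hs Set.univ 0).hasSum.sub ((hasSum_sum fun j _ => (hs _ j).hasSum).sub
      (hasSum_sum fun j _ => (hs _ j).hasSum))).congr_fun fun w => ?_
    rw [sum_staysIn_Icc_sub, if_pos (staysIn_univ w 0)]
    split_ifs <;> simp
  -- The weights `(1/2)^{|w_i|}` have total mass `(1 + 1/2)/(1 - 1/2) = 3` per letter, the source of
  -- the constant `3a`.
  have hb : HasSum (fun w : Fin m → ℤ =>
      (2 * q) ^ L * a ^ m * |t| ^ m / m ! * ∏ i, (1 / 2 : ℝ) ^ (w i).natAbs)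
      ((2 * q) ^ L * ((3 * a * |t|) ^ m / m !)) := by
    have := (hasSum_prod_fin (hasSum_pow_natAbs (r := 1 / 2) (by norm_num) (by norm_num))
      (fun k => by positivity) m).mul_left ((2 * q) ^ L * a ^ m * |t| ^ m / m !)
    have he : (2 * q) ^ L * a ^ m * |t| ^ m / (m ! : ℝ) * ((1 + 1 / 2) / (1 - 1 / 2)) ^ m
        = (2 * q) ^ L * ((3 * a * |t|) ^ m / m !) := by
      rw [show ((1 : ℝ) + 1 / 2) / (1 - 1 / 2) = 3 by norm_num, mul_pow, mul_pow]
      ring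
    exact he ▸ this
  rw [← hsum.tsum_eq]
  refine tsum_of_norm_bounded hb fun w => ?_
  split_ifs with h
  · rw [norm_zero]
    positivity
  · have hL : L ≤ ∑ i, (w i).natAbs := by
      have := pathMax_sub_pathMin_le m w
      rw [← Nat.cast_sum] at this
      omega
    refine (norm_wordIntegral_le hg hgf h1 m w t).trans ?_
    rw [Finset.prod_mul_distrib, Finset.prod_const, Finset.card_univ, Fintype.card_fin,
      Finset.prod_pow_eq_pow_sum, Finset.prod_pow_eq_pow_sum]
    -- Lowering the exponent of `2q` to `L` uses `2q ≤ 1`; the powers of `1/2` are kept to sum over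
    -- words.
    have hp : q ^ (∑ i, (w i).natAbs) ≤ (2 * q) ^ L * (1 / 2) ^ (∑ i, (w i).natAbs) := by
      calc q ^ (∑ i, (w i).natAbs)
          = (2 * q) ^ (∑ i, (w i).natAbs) * (1 / 2) ^ (∑ i, (w i).natAbs) := by
            rw [← mul_pow]; congr 1; ring
        _ ≤ _ := by
          gcongr ?_ * _
          exact pow_le_pow_of_le_one (by linarith) (by linarith) hL
    calc a ^ m * q ^ (∑ i, (w i).natAbs) * |t| ^ m / (m ! : ℝ)
        ≤ a ^ m * ((2 * q) ^ L * (1 / 2) ^ (∑ i, (w i).natAbs)) * |t| ^ m / (m ! : ℝ) := by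
          gcongr
      _ = _ := by ring

/-- Error bound for the difference of the two summed window systems on `[0, L]` and `[1, L]`. -/
theorem norm_sub_window_le (hg : ∀ k, Continuous (g k))
    (hgf : ∀ k t, ‖g k t‖ ≤ a * q ^ k.natAbs) (ha : 0 ≤ a) (hq0 : 0 ≤ q) (hq : q < 1 / 2)
    (h1 : ‖(1 : B)‖ ≤ 1) (L : ℕ) {Y : ℝ → B} (hY0 : Y 0 = 1)
    (hY : ∀ t, HasDerivAt Y (∑' k, g k t * Y t) t) {y z : ℤ → ℝ → B}
    (hy0 : ∀ j ∈ Set.Icc (0 : ℤ) L, y j 0 = 1)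
    (hy : ∀ j ∈ Set.Icc (0 : ℤ) L, ∀ t, HasDerivAt (y j)
      (∑' k, if j - k ∈ Set.Icc (0 : ℤ) L then g k t * y (j - k) t else 0) t)
    (hz0 : ∀ j ∈ Set.Icc (1 : ℤ) L, z j 0 = 1)
    (hz : ∀ j ∈ Set.Icc (1 : ℤ) L, ∀ t, HasDerivAt (z j)
      (∑' k, if j - k ∈ Set.Icc (1 : ℤ) L then g k t * z (j - k) t else 0) t) (t : ℝ) :
    ‖Y t - (∑ j ∈ Finset.Icc (0 : ℤ) L, y j t - ∑ j ∈ Finset.Icc (1 : ℤ) L, z j t)‖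
      ≤ (2 * q) ^ L * (Real.exp (3 * a * |t|) - 1) := by
  have hf := hasSum_geometric_coeff (a := a) hq0 (by linarith)
  have bdd : ∀ {x : ℝ → B}, (∀ t, ContinuousAt x t) → ∀ R, ∃ C, ∀ t, |t| ≤ R → ‖x t‖ ≤ C := by
    intro x hx R
    obtain ⟨C, hC⟩ := (isCompact_Icc (a := -R) (b := R)).exists_bound_of_continuousOn
      (f := x) fun t _ => (hx t).continuousWithinAt
    exact ⟨C, fun t ht => hC t (abs_le.1 ht)⟩
  have bdd_fin : ∀ (u v : ℤ) {x : ℤ → ℝ → B}, (∀ j ∈ Set.Icc u v, ∀ t, ContinuousAt (x j) t) →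
      ∀ R, ∃ C, ∀ j ∈ Set.Icc u v, ∀ t, |t| ≤ R → ‖x j t‖ ≤ C := by
    intro u v x hx R
    choose! C hC using fun j (hj : j ∈ Set.Icc u v) => bdd (hx j hj) R
    refine ⟨∑ j ∈ Finset.Icc u v, |C j|, fun j hj t ht => (hC j hj t ht).trans
      ((le_abs_self _).trans ?_)⟩
    exact Finset.single_le_sum (f := fun j => |C j|) (fun _ _ => abs_nonneg _)
      (Finset.mem_Icc.2 hj)
  have sY : HasSum (fun m => windowTerm g Set.univ m 0 t) (Y t) := by
    -- Without truncation, the family equal to `Y` at every site solves the convolution system.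
    refine hasSum_windowTerm hg hgf hf h1 (A := Set.univ) (y := fun _ => Y) (fun _ _ => hY0)
      (fun j _ s => by simpa using hY s) (fun R => ?_) (Set.mem_univ (0 : ℤ)) t
    obtain ⟨C, hC⟩ := bdd (fun s => (hY s).continuousAt) R
    exact ⟨C, fun _ _ => hC⟩
  have sy : ∀ j ∈ Finset.Icc (0 : ℤ) L,
      HasSum (fun m => windowTerm g (Set.Icc (0 : ℤ) L) m j t) (y j t) := fun j hj =>
    hasSum_windowTerm hg hgf hf h1 hy0 hy
      (bdd_fin _ _ fun j hj s => (hy j hj s).continuousAt) (Finset.mem_Icc.1 hj) t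
  have sz : ∀ j ∈ Finset.Icc (1 : ℤ) L,
      HasSum (fun m => windowTerm g (Set.Icc (1 : ℤ) L) m j t) (z j t) := fun j hj =>
    hasSum_windowTerm hg hgf hf h1 hz0 hz
      (bdd_fin _ _ fun j hj s => (hz j hj s).continuousAt) (Finset.mem_Icc.1 hj) t
  have hsum := sY.sub ((hasSum_sum sy).sub (hasSum_sum sz))
  have hexp : HasSum (fun m : ℕ => (3 * a * |t|) ^ m / (m ! : ℝ)) (Real.exp (3 * a * |t|)) := by
    rw [Real.exp_eq_exp_ℝ]
    exact NormedSpace.expSeries_div_hasSum_exp _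
  have hb : HasSum (fun m : ℕ => (2 * q) ^ L * ((3 * a * |t|) ^ m / (m ! : ℝ) - if m = 0 then 1 else 0))
      ((2 * q) ^ L * (Real.exp (3 * a * |t|) - 1)) :=
    (hexp.sub (hasSum_ite_eq 0 1)).mul_left _
  rw [← hsum.tsum_eq]
  refine tsum_of_norm_bounded hb fun m => ?_
  rcases Nat.eq_zero_or_pos m with rfl | hm
  -- Order zero cancels exactly, `1 - ((L + 1) - L) = 0`, which gives the `-1` in the bound.
  · have e1 : ∑ j ∈ Finset.Icc (0 : ℤ) L, windowTerm g (Set.Icc (0 : ℤ) L) 0 j t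
        = ∑ j ∈ Finset.Icc (0 : ℤ) L, (1 : B) := Finset.sum_congr rfl fun j hj =>
      windowTerm_zero_of_mem g (Finset.mem_Icc.1 hj) t
    have e2 : ∑ j ∈ Finset.Icc (1 : ℤ) L, windowTerm g (Set.Icc (1 : ℤ) L) 0 j t
        = ∑ j ∈ Finset.Icc (1 : ℤ) L, (1 : B) := Finset.sum_congr rfl fun j hj =>
      windowTerm_zero_of_mem g (Finset.mem_Icc.1 hj) t
    rw [e1, e2, windowTerm_zero_of_mem g (Set.mem_univ _)]
    simp only [Finset.sum_const, Int.card_Icc]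
    simp [show ((L : ℤ) + 1).toNat = L + 1 by omega, add_smul]
  · rw [if_neg hm.ne', sub_zero]
    exact norm_windowTerm_sub_le hg hgf ha hq0 hq h1 L m t

end ErrorBound

/-! ### From the subharmonic Hill matrix to two window systems -/

section Blocks

open scoped Matrix.Norms.Operator

/-- The index of `Fin (2 * M + 1)` with value `r`, for `0 ≤ r ≤ 2 * M`. -/
def rowIndex (M : ℕ) (r : ℤ) : Fin (2 * M + 1) := Fin.ofNat (2 * M + 1) r.toNat

lemma coe_rowIndex {M : ℕ} {r : ℤ} (h0 : 0 ≤ r) (h : r ≤ 2 * M) : ((rowIndex M r : ℕ) : ℤ) = r := by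
  have : r.toNat < 2 * M + 1 := by omega
  simp only [rowIndex, Fin.val_ofNat, Nat.mod_eq_of_lt this]
  omega

lemma blockIndex_rowIndex {M : ℕ} {r : ℤ} (h0 : 0 ≤ r) (h : r ≤ 2 * M) :
    blockIndex M (rowIndex M r) = r - M := by
  rw [blockIndex, coe_rowIndex h0 h]

lemma sum_range_two_mul_add_one {X : Type*} [AddCommMonoid X] (G : ℕ → X) (L : ℕ) :
    ∑ r ∈ Finset.range (2 * L + 1), G r
      = ∑ l ∈ Finset.range (L + 1), G (2 * l) + ∑ l ∈ Finset.range L, G (2 * l + 1) := by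
  induction L with
  | zero => simp
  | succ L ih =>
    rw [show 2 * (L + 1) + 1 = 2 * L + 1 + 1 + 1 by ring, Finset.sum_range_succ,
      Finset.sum_range_succ, ih, Finset.sum_range_succ _ (L + 1),
      Finset.sum_range_succ (fun l => G (2 * l + 1)) L]
    rw [show 2 * (L + 1) = 2 * L + 1 + 1 by ring]
    abel

/-- A sum over all rows, split into the even and the odd rows. -/
lemma sum_fin_eq_even_add_odd {X : Type*} [AddCommMonoid X] (L : ℕ) (F : Fin (2 * L + 1) → X) :
    ∑ r, F r = ∑ j ∈ Finset.Icc (0 : ℤ) L, F (rowIndex L (2 * j))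
      + ∑ j ∈ Finset.Icc (1 : ℤ) L, F (rowIndex L (2 * j - 1)) := by
  have h := Fin.sum_univ_eq_sum_range (fun r => F (Fin.ofNat (2 * L + 1) r)) (2 * L + 1)
  simp only [Fin.ofNat_val_eq_self] at h
  rw [h, sum_range_two_mul_add_one]
  congr 1
  · refine Finset.sum_nbij' (fun l => (l : ℤ)) (fun j => j.toNat) ?_ ?_ ?_ ?_ ?_
    · intro l hl; simp only [Finset.mem_range, Finset.mem_Icc] at *; omega
    · intro l hl; simp only [Finset.mem_range, Finset.mem_Icc] at *; omega
    · intro l hl; simp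
    · intro l hl; simp only [Finset.mem_Icc] at *; omega
    · intro l hl
      rw [rowIndex, show (2 * (l : ℤ)).toNat = 2 * l by omega]
  · refine Finset.sum_nbij' (fun l => (l : ℤ) + 1) (fun j => (j - 1).toNat) ?_ ?_ ?_ ?_ ?_
    · intro l hl; simp only [Finset.mem_range, Finset.mem_Icc] at *; omega
    · intro l hl; simp only [Finset.mem_range, Finset.mem_Icc] at *; omega
    · intro l hl; simp
    · intro l hl; simp only [Finset.mem_Icc] at *; omega
    · intro l hl
      rw [rowIndex, show (2 * ((l : ℤ) + 1) - 1).toNat = 2 * l + 1 by omega]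

variable {n : ℕ}

/-- Block row `r` of `e^{Ht} W`, multiplied by `e^{ikωt}` with `k` the index of the row. -/
noncomputable def phasedBlock (ω : ℝ) (c : ℤ → Matrix (Fin n) (Fin n) ℂ) (M : ℕ) (r : Fin (2 * M + 1)) (t : ℝ) :
    Matrix (Fin n) (Fin n) ℂ :=
  Matrix.of fun i j => Complex.exp (Complex.I * (blockIndex M r : ℂ) * (ω : ℂ) * (t : ℂ)) *
    (NormedSpace.exp ((t : ℂ) • hillMatrix ω c M)
      * Matrix.of fun x : Fin (2 * M + 1) × Fin n => fun j => if x.2 = j then (1 : ℂ) else 0) (r, i) j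

lemma phasedBlock_zero (ω : ℝ) (c : ℤ → Matrix (Fin n) (Fin n) ℂ) (M : ℕ)
    (r : Fin (2 * M + 1)) : phasedBlock ω c M r 0 = 1 := by
  ext i j
  simp [phasedBlock, Matrix.one_apply, NormedSpace.exp_zero]

lemma hasDerivAt_exp_smul_mul_apply {m l : Type*} [Fintype m] [DecidableEq m] [Finite l]
    (H : Matrix m m ℂ) (W : Matrix m l ℂ) (x : m) (j : l) (t : ℝ) :
    HasDerivAt (fun s : ℝ => (NormedSpace.exp ((s : ℂ) • H) * W) x j)
      ((H * (NormedSpace.exp ((t : ℂ) • H) * W)) x j) t := by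
  have h : HasDerivAt (fun s : ℝ => NormedSpace.exp ((s : ℂ) • H))
      (H * NormedSpace.exp ((t : ℂ) • H)) t := by
    have := hasDerivAt_exp_smul_const' (𝕂 := ℝ) H t
    simp only [Complex.coe_smul]
    exact this
  have he : ∀ y, HasDerivAt (fun s : ℝ => NormedSpace.exp ((s : ℂ) • H) x y)
      ((H * NormedSpace.exp ((t : ℂ) • H)) x y) t := fun y =>
    hasDerivAt_pi.1 (hasDerivAt_pi.1 h x) y
  rw [← Matrix.mul_assoc]
  simp only [Matrix.mul_apply (N := W)]
  exact HasDerivAt.fun_sum fun y _ => (he y).mul_const _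

lemma hillMatrix_mul_apply (ω : ℝ) (c : ℤ → Matrix (Fin n) (Fin n) ℂ) (M : ℕ)
    (G : Matrix (Fin (2 * M + 1) × Fin n) (Fin n) ℂ) (r : Fin (2 * M + 1)) (i j : Fin n) :
    (hillMatrix ω c M * G) (r, i) j
      = ∑ r', ∑ i', c (blockIndex M r - blockIndex M r') i i' * G (r', i') j
        - Complex.I * (blockIndex M r : ℂ) * (ω : ℂ) * G (r, i) j := by
  rw [Matrix.mul_apply]
  simp only [hillMatrix, Matrix.of_apply, sub_mul, Finset.sum_sub_distrib]
  congr 1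
  · rw [Fintype.sum_prod_type]
  · simp [ite_mul]

/-- The derivative of the phase cancels the diagonal term `-ikω`, and `e^{ikωt} = e^{i(k-l)ωt}
e^{ilωt}` moves the phase onto the coefficients. -/
lemma hasDerivAt_phasedBlock (ω : ℝ) (c : ℤ → Matrix (Fin n) (Fin n) ℂ) (M : ℕ)
    (r : Fin (2 * M + 1)) (t : ℝ) :
    HasDerivAt (phasedBlock ω c M r)
      (∑ r', (Complex.exp (Complex.I * ((blockIndex M r - blockIndex M r' : ℤ) : ℂ) * ω * t)
        • c (blockIndex M r - blockIndex M r')) * phasedBlock ω c M r' t) t := by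
  refine hasDerivAt_pi.2 fun i => hasDerivAt_pi.2 fun j => ?_
  have hG := hasDerivAt_exp_smul_mul_apply (hillMatrix ω c M)
    (Matrix.of fun x : Fin (2 * M + 1) × Fin n => fun j => if x.2 = j then (1 : ℂ) else 0) (r, i) j t
  have hE : HasDerivAt
      (fun s : ℝ => Complex.exp (Complex.I * (blockIndex M r : ℂ) * (ω : ℂ) * (s : ℂ)))
      (Complex.exp (Complex.I * (blockIndex M r : ℂ) * (ω : ℂ) * (t : ℂ))
        * (Complex.I * (blockIndex M r : ℂ) * (ω : ℂ))) t := by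
    have h1 : HasDerivAt (fun s : ℝ => (s : ℂ)) 1 t := Complex.ofRealCLM.hasDerivAt
    simpa using (h1.const_mul (Complex.I * (blockIndex M r : ℂ) * (ω : ℂ))).cexp
  refine (hE.mul hG).congr_deriv ?_
  rw [hillMatrix_mul_apply, Matrix.sum_apply, mul_sub, Finset.mul_sum]
  rw [add_comm, sub_add_eq_add_sub, sub_eq_iff_eq_add]
  congr 1
  · refine Finset.sum_congr rfl fun r' _ => ?_
    rw [Matrix.mul_apply, Finset.mul_sum]
    refine Finset.sum_congr rfl fun i' _ => ?_
    simp only [phasedBlock, Matrix.smul_apply, Matrix.of_apply, smul_eq_mul]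
    rw [show Complex.I * (blockIndex M r : ℂ) * (ω : ℂ) * (t : ℂ)
      = Complex.I * ((blockIndex M r - blockIndex M r' : ℤ) : ℂ) * ω * t
        + Complex.I * (blockIndex M r' : ℂ) * (ω : ℂ) * (t : ℂ) by push_cast; ring, Complex.exp_add]
    ring
  · ring

/-- Half-integers times `ω` are integers times `ω/2`, so `e^{iωD̃t}` supplies exactly the phases of
`phasedBlock` at frequency `ω/2`. -/
lemma subhProjection_eq_sum (ω : ℝ) (c : ℤ → Matrix (Fin n) (Fin n) ℂ) (N : ℕ) (t : ℝ) :
    subhProjection ω c N t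
      = ∑ r : Fin (2 * (2 * N) + 1),
        (-1 : ℂ) ^ (r : ℕ) • phasedBlock (ω / 2) (subhCoeff c) (2 * N) r t := by
  have hD : NormedSpace.exp ((Complex.I * (ω : ℂ) * (t : ℂ)) • subhD n N)
      = Matrix.diagonal fun x : Fin (2 * (2 * N) + 1) × Fin n =>
        Complex.exp (Complex.I * (blockIndex (2 * N) x.1 : ℂ) * ((ω / 2 : ℝ) : ℂ) * (t : ℂ)) := by
    rw [subhD, ← Matrix.diagonal_smul, Matrix.exp_diagonal]
    congr 1
    ext x
    rw [Pi.coe_exp, ← Complex.exp_eq_exp_ℂ]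
    congr 1
    simp only [Pi.smul_apply, smul_eq_mul]
    push_cast
    ring
  ext i j
  rw [subhProjection, hD, Matrix.mul_assoc, Matrix.mul_apply, Fintype.sum_prod_type,
    Matrix.sum_apply]
  refine Finset.sum_congr rfl fun r _ => ?_
  simp only [Matrix.mul_diagonal, subhC, Matrix.of_apply, Matrix.smul_apply, phasedBlock,
    smul_eq_mul, ite_mul, zero_mul]
  rw [Finset.sum_ite_eq, if_pos (Finset.mem_univ _), mul_assoc]
  rfl

/-- The even and the odd rows of the subharmonic system decouple: `s = 0` gives the even rows, with
window `[0, 2N]`, and `s = 1` the odd rows, with window `[1, 2N]`. -/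
lemma hasDerivAt_subharmonic_row (ω : ℝ) (c : ℤ → Matrix (Fin n) (Fin n) ℂ) (N : ℕ) {s : ℤ}
    (hs : s = 0 ∨ s = 1) {j : ℤ} (hj : j ∈ Finset.Icc s ((2 * N : ℕ) : ℤ)) (t : ℝ) :
    HasDerivAt (phasedBlock (ω / 2) (subhCoeff c) (2 * N) (rowIndex (2 * N) (2 * j - s)))
      (∑ l ∈ Finset.Icc s ((2 * N : ℕ) : ℤ),
        (Complex.exp (Complex.I * ((j - l : ℤ) : ℂ) * ω * t) • c (j - l))
          * phasedBlock (ω / 2) (subhCoeff c) (2 * N) (rowIndex (2 * N) (2 * l - s)) t) t := by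
  refine (hasDerivAt_phasedBlock (ω / 2) (subhCoeff c) (2 * N) _ t).congr_deriv ?_
  rw [Finset.mem_Icc] at hj
  have same : ∀ l ∈ Finset.Icc s ((2 * N : ℕ) : ℤ),
      blockIndex (2 * N) (rowIndex (2 * N) (2 * j - s))
        - blockIndex (2 * N) (rowIndex (2 * N) (2 * l - s)) = 2 * (j - l) := by
    intro l hl
    rw [Finset.mem_Icc] at hl
    rw [blockIndex_rowIndex (by omega) (by omega), blockIndex_rowIndex (by omega) (by omega)]
    ring
  have hsame : ∀ l ∈ Finset.Icc s ((2 * N : ℕ) : ℤ),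
      Complex.exp (Complex.I * ((2 * (j - l) : ℤ) : ℂ) * ((ω / 2 : ℝ) : ℂ) * t)
        • subhCoeff c (2 * (j - l))
      = Complex.exp (Complex.I * ((j - l : ℤ) : ℂ) * ω * t) • c (j - l) := by
    intro l _
    rw [subhCoeff, if_pos (even_two_mul _), Int.mul_ediv_cancel_left _ two_ne_zero]
    congr 2
    push_cast
    ring
  -- Rows of opposite parity differ by an odd index, so their coupling vanishes.
  have hodd : ∀ k : ℤ, subhCoeff c (2 * k + 1) = 0 := fun k => if_neg (by simp)
  rw [sum_fin_eq_even_add_odd]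
  rcases hs with rfl | rfl
  · rw [Finset.sum_eq_zero (s := Finset.Icc (1 : ℤ) _) fun l hl => ?_, add_zero]
    · refine Finset.sum_congr rfl fun l hl => ?_
      have h := same l hl
      rw [sub_zero (2 * l)] at h
      rw [h, hsame l hl, sub_zero]
    · rw [Finset.mem_Icc] at hl
      rw [blockIndex_rowIndex (r := 2 * l - 1) (by omega) (by omega),
        blockIndex_rowIndex (by omega) (by omega),
        show 2 * j - 0 - ((2 * N : ℕ) : ℤ) - (2 * l - 1 - ((2 * N : ℕ) : ℤ)) = 2 * (j - l) + 1 by ring,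
        hodd, smul_zero, zero_mul]
  · rw [Finset.sum_eq_zero (s := Finset.Icc (0 : ℤ) _) fun l hl => ?_, zero_add]
    · refine Finset.sum_congr rfl fun l hl => ?_
      rw [same l hl, hsame l hl]
    · rw [Finset.mem_Icc] at hl
      rw [blockIndex_rowIndex (r := 2 * l) (by omega) (by omega),
        blockIndex_rowIndex (by omega) (by omega),
        show 2 * j - 1 - ((2 * N : ℕ) : ℤ) - (2 * l - ((2 * N : ℕ) : ℤ)) = 2 * (j - l - 1) + 1 by ring,
        hodd, smul_zero, zero_mul]

lemma subhProjection_eq_sub (ω : ℝ) (c : ℤ → Matrix (Fin n) (Fin n) ℂ) (N : ℕ) (t : ℝ) :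
    subhProjection ω c N t
      = ∑ j ∈ Finset.Icc (0 : ℤ) ((2 * N : ℕ) : ℤ),
          phasedBlock (ω / 2) (subhCoeff c) (2 * N) (rowIndex (2 * N) (2 * j - 0)) t
        - ∑ j ∈ Finset.Icc (1 : ℤ) ((2 * N : ℕ) : ℤ),
          phasedBlock (ω / 2) (subhCoeff c) (2 * N) (rowIndex (2 * N) (2 * j - 1)) t := by
  rw [subhProjection_eq_sum, sum_fin_eq_even_add_odd, sub_eq_add_neg, ← Finset.sum_neg_distrib]
  congr 1
  · refine Finset.sum_congr rfl fun j hj => ?_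
    rw [Finset.mem_Icc] at hj
    have h := coe_rowIndex (M := 2 * N) (r := 2 * j) (by omega) (by omega)
    rw [Even.neg_one_pow (by grind), one_smul, sub_zero]
  · refine Finset.sum_congr rfl fun j hj => ?_
    rw [Finset.mem_Icc] at hj
    have h := coe_rowIndex (M := 2 * N) (r := 2 * j - 1) (by omega) (by omega)
    rw [Odd.neg_one_pow (by grind), neg_one_smul]

end Blocks

/-! ### Passage to operators with the induced `p`-norm -/

section Transport

open scoped Matrix.Norms.Operator

variable {n : ℕ} (p : ℝ≥0∞) [Fact (1 ≤ p)]

/-- A matrix as a bounded operator on `ℂⁿ` with the `ℓᵖ` norm. -/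
noncomputable def toLpCLM : Matrix (Fin n) (Fin n) ℂ ≃ₗ[ℂ]
    (WithLp p (Fin n → ℂ) →L[ℂ] WithLp p (Fin n → ℂ)) :=
  (Matrix.toLpLin p p).trans LinearMap.toContinuousLinearMap

lemma norm_toLpCLM (A : Matrix (Fin n) (Fin n) ℂ) : ‖toLpCLM p A‖ = matPNorm p A := rfl

lemma toLpCLM_one : toLpCLM p (1 : Matrix (Fin n) (Fin n) ℂ) = 1 := by
  ext x : 1
  simp [toLpCLM]

lemma toLpCLM_mul (A C : Matrix (Fin n) (Fin n) ℂ) :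
    toLpCLM p (A * C) = toLpCLM p A * toLpCLM p C := by
  ext x : 1
  simp [toLpCLM]

lemma continuous_toLpCLM : Continuous (toLpCLM (n := n) p) :=
  (toLpCLM p).toLinearMap.continuous_of_finiteDimensional

lemma continuous_toLpCLM_symm : Continuous (toLpCLM (n := n) p).symm :=
  (toLpCLM p).symm.toLinearMap.continuous_of_finiteDimensional

lemma hasDerivAt_toLpCLM {F : ℝ → Matrix (Fin n) (Fin n) ℂ} {F' : Matrix (Fin n) (Fin n) ℂ}
    {t : ℝ} (h : HasDerivAt F F' t) : HasDerivAt (fun s => toLpCLM p (F s)) (toLpCLM p F') t := by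
  let T : Matrix (Fin n) (Fin n) ℂ →L[ℝ] (WithLp p (Fin n → ℂ) →L[ℂ] WithLp p (Fin n → ℂ)) :=
    ⟨(toLpCLM p).toLinearMap.restrictScalars ℝ, continuous_toLpCLM p⟩
  exact T.hasFDerivAt.comp_hasDerivAt t h

end Transport

lemma tsum_ite_mem_Icc_sub {X : Type*} [AddCommGroup X] [TopologicalSpace X] (u v j : ℤ)
    (F : ℤ → X) :
    ∑' k, (if j - k ∈ Set.Icc u v then F k else 0) = ∑ l ∈ Finset.Icc u v, F (j - l) := by
  rw [← (Equiv.subLeft j).tsum_eq, tsum_eq_sum (s := Finset.Icc u v)]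
  · refine Finset.sum_congr rfl fun l hl => ?_
    rw [Equiv.subLeft_apply, sub_sub_cancel, if_pos (Set.mem_Icc.2 (Finset.mem_Icc.1 hl))]
  · intro l hl
    rw [Equiv.subLeft_apply, sub_sub_cancel, if_neg (mt (fun h => Finset.mem_Icc.2 (Set.mem_Icc.1 h)) hl)]

/-! ### Error bound, convergence and truncation order -/

section Projection

variable {n : ℕ} {p : ℝ≥0∞} [Fact (1 ≤ p)] {ω a b : ℝ} {c : ℤ → Matrix (Fin n) (Fin n) ℂ}

lemma two_mul_exp_neg (b : ℝ) : 2 * Real.exp (-b) = Real.exp (-(b - Real.log 2)) := by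
  rw [neg_sub, sub_eq_add_neg, Real.exp_add, Real.exp_log two_pos]

/-- The error bound with the sharper exponent `3a|t|`. -/
theorem matPNorm_sub_subhProjection_le_sharp {J Φ : ℝ → Matrix (Fin n) (Fin n) ℂ}
    (hJ : IsFourierSum ω c J) (hc : ExpDecay p a b c) (hb : Real.log 2 < b)
    (hΦ : IsFundamentalSolution J Φ) (N : ℕ) (t : ℝ) :
    matPNorm p (Φ t - subhProjection ω c N t)
      ≤ (2 * Real.exp (-b)) ^ (2 * N) * (Real.exp (3 * a * |t|) - 1) := by
  set g : ℤ → ℝ → (WithLp p (Fin n → ℂ) →L[ℂ] WithLp p (Fin n → ℂ)) := fun k t =>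
    toLpCLM p (Complex.exp (Complex.I * (k : ℂ) * (ω : ℂ) * (t : ℂ)) • c k) with hg
  have hgc : ∀ k, Continuous (g k) := fun k => by
    simp only [hg, map_smul]
    fun_prop
  have hgb : ∀ k t, ‖g k t‖ ≤ a * Real.exp (-b) ^ k.natAbs := by
    intro k t
    have h := hc.2.2 k
    have he : ‖Complex.exp (Complex.I * (k : ℂ) * (ω : ℂ) * (t : ℂ))‖ = 1 := by
      rw [show Complex.I * (k : ℂ) * (ω : ℂ) * (t : ℂ) = ((k * ω * t : ℝ) : ℂ) * Complex.I by
        push_cast; ring]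
      exact Complex.norm_exp_ofReal_mul_I _
    simp only [hg, map_smul, norm_smul, he, one_mul, norm_toLpCLM]
    refine h.trans_eq ?_
    rw [← Real.exp_nat_mul, Nat.cast_natAbs, Int.cast_abs, mul_comm |(k : ℝ)|]
  have hq : Real.exp (-b) < 1 / 2 := by
    have h : 2 * Real.exp (-b) < 1 := by
      rw [two_mul_exp_neg, Real.exp_lt_one_iff]
      linarith
    linarith
  have hgs : ∀ t, Summable fun k => g k t := fun t =>
    Summable.of_norm_bounded
      (hasSum_geometric_coeff (a := a) (Real.exp_pos (-b)).le (by linarith)).summable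
      fun k => hgb k t
  -- Exponential decay gives unconditional summability, so the sum agrees with the limit of the
  -- symmetric partial sums.
  have hgJ : ∀ t, ∑' k, g k t = toLpCLM p (J t) := by
    intro t
    have h1 := (hgs t).hasSum.comp (Finset.tendsto_Icc_neg (R := ℤ))
    refine tendsto_nhds_unique h1 ?_
    have h2 := ((continuous_toLpCLM p).tendsto _).comp (hJ t)
    refine h2.congr fun K => ?_
    simp [hg]
  -- Only an inequality, since for `n = 0` the identity has norm 0.
  have h1 : ‖(1 : WithLp p (Fin n → ℂ) →L[ℂ] WithLp p (Fin n → ℂ))‖ ≤ 1 :=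
    ContinuousLinearMap.norm_id_le
  have hwin : ∀ s : ℤ, s = 0 ∨ s = 1 → ∀ j ∈ Set.Icc s ((2 * N : ℕ) : ℤ), ∀ t,
      HasDerivAt (fun t => toLpCLM p
        (phasedBlock (ω / 2) (subhCoeff c) (2 * N) (rowIndex (2 * N) (2 * j - s)) t))
      (∑' k, if j - k ∈ Set.Icc s ((2 * N : ℕ) : ℤ) then g k t * toLpCLM p
        (phasedBlock (ω / 2) (subhCoeff c) (2 * N) (rowIndex (2 * N) (2 * (j - k) - s)) t)
        else 0) t := by
    intro s hs j hj t
    refine (hasDerivAt_toLpCLM p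
      (hasDerivAt_subharmonic_row ω c N hs (Finset.mem_Icc.2 hj) t)).congr_deriv ?_
    rw [tsum_ite_mem_Icc_sub, map_sum]
    refine Finset.sum_congr rfl fun l _ => ?_
    rw [toLpCLM_mul, sub_sub_cancel]
  have hone : ∀ r, toLpCLM p (phasedBlock (ω / 2) (subhCoeff c) (2 * N) r 0) = 1 := fun r => by
    rw [phasedBlock_zero, toLpCLM_one]
  have key := norm_sub_window_le hgc hgb hc.1.le (Real.exp_pos _).le hq h1 (2 * N)
    (Y := fun t => toLpCLM p (Φ t)) (by rw [hΦ.1, toLpCLM_one])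
    (fun t => (hasDerivAt_toLpCLM p (hΦ.2 t)).congr_deriv <| by
      rw [(hgs t).tsum_mul_right, hgJ, toLpCLM_mul])
    (fun _ _ => hone _) (hwin 0 (Or.inl rfl)) (fun _ _ => hone _) (hwin 1 (Or.inr rfl)) t
  rw [← norm_toLpCLM, subhProjection_eq_sub, map_sub, map_sub, map_sum, map_sum]
  exact key

theorem matPNorm_sub_subhProjection_le {J Φ : ℝ → Matrix (Fin n) (Fin n) ℂ}
    (hJ : IsFourierSum ω c J) (hc : ExpDecay p a b c) (hb : Real.log 2 < b)
    (hΦ : IsFundamentalSolution J Φ) (N : ℕ) (t : ℝ) :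
    matPNorm p (Φ t - subhProjection ω c N t) ≤ subhBound a b t N := by
  refine (matPNorm_sub_subhProjection_le_sharp hJ hc hb hΦ N t).trans ?_
  have ha := hc.1
  rw [subhBound, abs_mul, abs_of_pos (by positivity : 0 < 4 * a)]
  gcongr
  norm_num

lemma directBound_eq (a b t : ℝ) (N : ℕ) :
    directBound a b t N = Real.exp (-(b - Real.log 2) * N) * (Real.exp |4 * a * t| - 1) := by
  rw [directBound, two_mul_exp_neg, ← Real.exp_nat_mul, mul_comm (N : ℝ)]

lemma subhBound_eq (a b t : ℝ) (N : ℕ) :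
    subhBound a b t N
      = Real.exp (-(2 * (b - Real.log 2)) * N) * (Real.exp |4 * a * t| - 1) := by
  rw [subhBound, two_mul_exp_neg, ← Real.exp_nat_mul]
  congr 2
  push_cast
  ring

lemma tendsto_subhBound (a t : ℝ) (hb : Real.log 2 < b) :
    Tendsto (subhBound a b t) atTop (𝓝 0) := by
  have h : Tendsto (fun N : ℕ => ((2 * Real.exp (-b)) ^ 2) ^ N * (Real.exp |4 * a * t| - 1)) atTop
      (𝓝 (0 * (Real.exp |4 * a * t| - 1))) := by
    refine (tendsto_pow_atTop_nhds_zero_of_lt_one (by positivity) ?_).mul_const _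
    refine pow_lt_one₀ (by positivity) ?_ two_ne_zero
    rw [two_mul_exp_neg, Real.exp_lt_one_iff]
    linarith
  rw [zero_mul] at h
  refine h.congr fun N => ?_
  rw [subhBound, pow_mul]

/-- With `x = |4at| > 0`, `e^x - 1 = exp(x + ln(1 - e^{-x}))`, so the claim is linear after taking
logarithms. At `t = 0` the bound is 0. -/
lemma subhBound_le_of_subhOrder_le {t E : ℝ} (ha : a ≠ 0) (hb : Real.log 2 < b) (hE : 0 < E)
    (N : ℕ) (hN : t ≠ 0 → subhOrder a b t E ≤ N) : subhBound a b t N ≤ E := by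
  rcases eq_or_ne t 0 with rfl | ht
  · simpa [subhBound] using hE.le
  · have hx : 0 < |4 * a * t| := abs_pos.2 (by positivity)
    have h := hN ht
    rw [subhOrder, div_le_iff₀ (by linarith)] at h
    rw [subhBound_eq]
    set x := |4 * a * t|
    have hpos : 0 < 1 - Real.exp (-x) := by
      rw [sub_pos, Real.exp_lt_one_iff]
      linarith
    have he : Real.exp x - 1 = Real.exp (x + Real.log (1 - Real.exp (-x))) := by
      rw [Real.exp_add, Real.exp_log hpos, mul_sub, ← Real.exp_add]
      simp
    rw [he, ← Real.exp_add, ← Real.le_log_iff_exp_le hE]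
    linarith

lemma subhOrder_eq (a b t E : ℝ) : subhOrder a b t E = directOrder a b t E / 2 := by
  rw [subhOrder, directOrder, div_div, mul_comm 2]

/-- In finite dimension the inverse of `toLpCLM` is continuous, so convergence in the `p`-norm is
convergence of matrices. -/
lemma tendsto_of_matPNorm_sub_le {A : ℕ → Matrix (Fin n) (Fin n) ℂ} {A₀ : Matrix (Fin n) (Fin n) ℂ}
    {e : ℕ → ℝ} (h : ∀ N, matPNorm p (A₀ - A N) ≤ e N) (he : Tendsto e atTop (𝓝 0)) :
    Tendsto A atTop (𝓝 A₀) := by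
  have h1 : Tendsto (fun N => toLpCLM p (A N)) atTop (𝓝 (toLpCLM p A₀)) := by
    rw [tendsto_iff_norm_sub_tendsto_zero]
    refine squeeze_zero (fun _ => norm_nonneg _) (fun N => ?_) he
    rw [norm_sub_rev, ← map_sub, norm_toLpCLM]
    exact h N
  simpa [Function.comp_def] using ((continuous_toLpCLM_symm p).tendsto _).comp h1

end Projection

end KoopmanHill

theorem theorem5 {n : ℕ} {T : ℝ} (hT : 0 < T)
    (J : ℝ → Matrix (Fin n) (Fin n) ℂ) (hJper : Function.Periodic J T)
    (hJ : KoopmanHill.IsFourierSum (2 * Real.pi / T) (KoopmanHill.fourierCoeffMatrix hT J) J)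
    (p : ℝ≥0∞) [Fact (1 ≤ p)] (a b : ℝ)
    (hdecay : KoopmanHill.ExpDecay p a b (KoopmanHill.fourierCoeffMatrix hT J))
    (hb : Real.log 2 < b)
    (Φ : ℝ → Matrix (Fin n) (Fin n) ℂ) (hΦ : KoopmanHill.IsFundamentalSolution J Φ) :
    -- the error bound
    (∀ (N : ℕ) (t : ℝ),
      KoopmanHill.matPNorm p (Φ t - KoopmanHill.subhProjection (2 * Real.pi / T)
        (KoopmanHill.fourierCoeffMatrix hT J) N t) ≤ KoopmanHill.subhBound a b t N) ∧
    -- the bound decays exponentially in `N`, at twice the (positive) rate of the direct bound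
    0 < b - Real.log 2 ∧
    (∀ (N : ℕ) (t : ℝ),
      KoopmanHill.directBound a b t N =
        Real.exp (-(b - Real.log 2) * N) * (Real.exp |4 * a * t| - 1) ∧
      KoopmanHill.subhBound a b t N =
        Real.exp (-(2 * (b - Real.log 2)) * N) * (Real.exp |4 * a * t| - 1)) ∧
    -- convergence of the projection as `N → ∞`
    (∀ t : ℝ, Tendsto (fun N : ℕ => KoopmanHill.subhProjection (2 * Real.pi / T)
        (KoopmanHill.fourierCoeffMatrix hT J) N t) atTop (𝓝 (Φ t))) ∧
    -- a sufficient truncation order for a desired accuracy (at `t = 0` every order suffices)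
    (∀ (N : ℕ) (t E : ℝ), 0 < E → (t ≠ 0 → KoopmanHill.subhOrder a b t E ≤ N) →
      KoopmanHill.matPNorm p (Φ t - KoopmanHill.subhProjection (2 * Real.pi / T)
        (KoopmanHill.fourierCoeffMatrix hT J) N t) ≤ E) ∧
    -- it is one half of the one for the direct formulation
    (∀ t E : ℝ, KoopmanHill.subhOrder a b t E = KoopmanHill.directOrder a b t E / 2) := by
  have hbound := KoopmanHill.matPNorm_sub_subhProjection_le hJ hdecay hb hΦ
  refine ⟨hbound, sub_pos.2 hb,
    fun N t => ⟨KoopmanHill.directBound_eq a b t N, KoopmanHill.subhBound_eq a b t N⟩,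
    fun t => KoopmanHill.tendsto_of_matPNorm_sub_le (fun N => hbound N t)
      (KoopmanHill.tendsto_subhBound a t hb),
    fun N t E hE hN => (hbound N t).trans
      (KoopmanHill.subhBound_le_of_subhOrder_le hdecay.1.ne' hb hE N hN),
    KoopmanHill.subhOrder_eq a b⟩
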